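/- **Setting.** Let $q(x_1,\dots,x_k)\,{:}{-}\,S_1(\mathbf y_1),\dots,S_l(\mathbf y_l)$ be a full conjunctive query without self-joins; atom $S_j$ has arity $r_j\ge 1$, the variables within one atom are distinct, and every variable occurs in some atom. A fractional edge packing of $q$ is a vector $\mathbf u=(u_1,\dots,u_l)$ with $u_j\ge 0$ and $\sum_{j:\,x_i\in S_j}u_j\le 1$ for every variable $x_i$. The domain is $[n]$ with $n\ge 2$, and relation $S_j$ has $m_j\ge 1$ tuples. Consider two input distributions: * $\mathcal I$: the uniform distribution on matching databases, i.e. databases with $|S_j|=m_j$ such that in every attribute of every $S_j$ each value of $[n]$ occurs at most once; here $m_j\le n$, and $m_j\le\theta n$ whenever $r_j=1$; * $\mathcal I^d$: the uniform distribution on $\theta$-dense databases, i.e. databases with $|S_j|=m_j=\theta n^{r_j}$ for all $j$. There are $p$ machines with linear costs $g_c(N)=N/w_c$, where $w_c\ge 0$ and at least one $w_c$ is positive (if $w_c=0$, the cost is $0$ for $N=0$ and $\infty$ otherwise). In a one-round algorithm each relation is initially stored at a separate location; the location of $S_j$ sends to each machine $c$ a bit string depending only on $S_j$ (and, for randomized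 algorithms, on a shared random seed independent of the input), after which machine $c$ outputs a set of tuples depending only on the strings it received (and the seed). The output of the algorithm is the union of the outputs of the machines, and it may contain only tuples of $q(I)$. If machine $c$ receives $N_c$ bits in total, the load is the maximum of $N_c/w_c$ over all machines, all inputs in the support of the distribution, and all seeds. **Theorem.** For every $\theta\in(0,1)$ there is a constant $\kappa>0$, depending only on $\theta$, such that the following holds for all $q$, $n$, $p$, $(m_j)$, $(w_c)$ as above and any choice of a fractional edge packing $\mathbf u_c=(u_{c,1},\dots,u_{c,l})$ of $q$ for each machine $c$. There is a smallest $L\ge 0$ with $$\sum_{c\in[p]}\prod_{j\in[l]}\left(\frac{L\,w_c}{m_j}\right)^{u_{c,j}}\ \ge\ 1 \qquad(\text{where } 0^0=1),$$ and every one-round algorithm that on inputs $I\sim\mathcal I$ outputs in expectation at least $\mathbb E_{I\sim\mathcal I}[|q(I)|]$ tuples has load at least $\kappa L$. The same holds with $\mathcal I^d$ in place of $\mathcal I$. -/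

import Mathlib

open scoped BigOperators ENNReal

universe u

/-- A full conjunctive query (natural join) without self-joins, with variables `x_i`, `i : Fin k`,
and atoms `S_j`, `j : Fin l`. The variables of one atom are pairwise distinct (there are no
selections), every atom has at least one variable, and every variable occurs in some atom. -/
structure ConjunctiveQuery (k l : ℕ) where
  /-- the arity `r_j` of `S_j` -/
  arity : Fin l → ℕ
  arity_pos : ∀ j, 0 < arity j
  /-- `var j a` is the variable at attribute `a` of the atom `S_j` -/
  var : ∀ j, Fin (arity j) → Fin k
  var_injective : ∀ j, Function.Injective (var j)
  var_covers : ∀ i, ∃ j a, var j a = i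

/-- A relation of arity `r` over a domain with `n` values. -/
abbrev Relation (n r : ℕ) : Type := Finset (Fin r → Fin n)

/-- A relation is a matching if every value occurs at most once in every attribute. -/
def Relation.IsMatching {n r : ℕ} (R : Relation n r) : Prop :=
  ∀ a : Fin r, ∀ s ∈ R, ∀ t ∈ R, s a = t a → s = t

namespace ConjunctiveQuery

variable {k l : ℕ}

/-- An instance: one relation for every atom. -/
abbrev Database (q : ConjunctiveQuery k l) (n : ℕ) : Type := ∀ j, Relation n (q.arity j)

/-- The output `q(I)`. -/
def eval (q : ConjunctiveQuery k l) {n : ℕ} (I : q.Database n) : Finset (Fin k → Fin n) :=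
  Finset.univ.filter fun a => ∀ j, (fun i => a (q.var j i)) ∈ I j

/-- Nonnegative weights on the atoms such that, for every variable, the atoms that contain it have
total weight at most one. -/
def IsFractionalEdgePacking (q : ConjunctiveQuery k l) (v : Fin l → ℝ) : Prop :=
  (∀ j, 0 ≤ v j) ∧
    ∀ i : Fin k, ∑ j ∈ Finset.univ.filter (fun j => ∃ a, q.var j a = i), v j ≤ 1

open Classical in
/-- All databases in which `S_j` has `m j` tuples. With `m j = θ * n ^ r_j` these are the
`θ`-dense databases. -/
noncomputable def instances (q : ConjunctiveQuery k l) (n : ℕ) (m : Fin l → ℕ) :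
    Finset (q.Database n) :=
  Finset.univ.filter fun I => ∀ j, (I j).card = m j

open Classical in
/-- All matching databases in which `S_j` has `m j` tuples. -/
noncomputable def matchingInstances (q : ConjunctiveQuery k l) (n : ℕ) (m : Fin l → ℕ) :
    Finset (q.Database n) :=
  Finset.univ.filter fun I => ∀ j, (I j).card = m j ∧ (I j).IsMatching

/-- The expected output size `E[|q(I)|]` for `I` uniform in the finite set `D`. -/
noncomputable def expectedSize (q : ConjunctiveQuery k l) {n : ℕ}
    (D : Finset (q.Database n)) : ℝ :=
  (∑ I ∈ D, ((q.eval I).card : ℝ)) / (D.card : ℝ)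

end ConjunctiveQuery

/-- A one-round algorithm on `p` machines. Every relation is initially stored at its own location.
In the communication phase the location of `S_j` sends to machine `c` a bit string that depends on
`S_j` only; in the computation phase machine `c` outputs a set of tuples that depends only on the
strings that it received. The random seed `ω : Ω`, shared by all the parties, makes randomized
algorithms a special case; deterministic algorithms are those that ignore it. There is no
restriction on local computation. -/
structure OneRoundAlgorithm {k l : ℕ} (q : ConjunctiveQuery k l) (n p : ℕ) (Ω : Type u) where
  msg : Ω → Fin p → ∀ j, Relation n (q.arity j) → List Bool
  out : Ω → Fin p → (Fin l → List Bool) → Finset (Fin k → Fin n)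

namespace OneRoundAlgorithm

variable {k l n p : ℕ} {q : ConjunctiveQuery k l} {Ω : Type u}

/-- The number `N_c` of bits that machine `c` receives on the input `I`. -/
def bitsReceived (A : OneRoundAlgorithm q n p Ω) (ω : Ω) (I : q.Database n) (c : Fin p) : ℕ :=
  ∑ j, (A.msg ω c j (I j)).length

/-- The output of the algorithm: the union of the outputs of all the machines. -/
def output (A : OneRoundAlgorithm q n p Ω) (ω : Ω) (I : q.Database n) :
    Finset (Fin k → Fin n) :=
  Finset.univ.biUnion fun c => A.out ω c fun j => A.msg ω c j (I j)

/-- On the inputs in `D` the algorithm outputs only tuples of `q(I)`. -/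
def IsSoundOn (A : OneRoundAlgorithm q n p Ω) (D : Finset (q.Database n)) : Prop :=
  ∀ ω, ∀ I ∈ D, A.output ω I ⊆ q.eval I

/-- The expected number of output tuples for `I` uniform in `D` and an independent seed with
law `P`. -/
noncomputable def expectedOutput [MeasurableSpace Ω] (A : OneRoundAlgorithm q n p Ω)
    (P : MeasureTheory.Measure Ω) (D : Finset (q.Database n)) : ℝ :=
  ∫ ω, (∑ I ∈ D, ((A.output ω I).card : ℝ)) / (D.card : ℝ) ∂P

/-- The load in the linear cost model: the maximal cost `N_c / w_c` over the machines, the inputs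
in `D` and the seeds (a machine of weight zero has cost `0` if it receives nothing and cost `∞`
otherwise). -/
noncomputable def load (A : OneRoundAlgorithm q n p Ω) (w : Fin p → ℝ)
    (D : Finset (q.Database n)) : ℝ≥0∞ :=
  ⨆ ω, ⨆ I ∈ D, ⨆ c, (A.bitsReceived ω I c : ℝ≥0∞) / ENNReal.ofReal (w c)

end OneRoundAlgorithm

/-- The numbers `L ≥ 0` with `∑_c ∏_j (L w_c / m_j) ^ u_{c,j} ≥ 1`, where `0 ^ 0 = 1`. -/
def admissibleLoads {l p : ℕ} (m : Fin l → ℕ) (w : Fin p → ℝ) (v : Fin p → Fin l → ℝ) : Set ℝ :=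
  {L | 0 ≤ L ∧ 1 ≤ ∑ c, ∏ j, (L * w c / (m j : ℝ)) ^ (v c j)}

/-- Every one-round algorithm on `p` machines with weights `w` that outputs only correct tuples and
that, for inputs uniform in `D`, outputs in expectation at least `E[|q(I)|]` tuples has load at
least `B`. -/
def OneRoundLoadAtLeast {k l n p : ℕ} (q : ConjunctiveQuery k l) (D : Finset (q.Database n))
    (w : Fin p → ℝ) (B : ℝ) : Prop :=
  ∀ (Ω : Type u) [MeasurableSpace Ω] (P : MeasureTheory.Measure Ω)
    [MeasureTheory.IsProbabilityMeasure P] (A : OneRoundAlgorithm q n p Ω),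
    A.IsSoundOn D → q.expectedSize D ≤ A.expectedOutput P D →
      ENNReal.ofReal B ≤ A.load w D

/-!
Given the message about a relation `S`, a machine knows of `S` only the tuples that belong to every
relation with the same message. As it may output correct tuples only, all that it outputs are joins
of known tuples.

In both distributions the relations are independent, and each is uniform in a family that is
`ρ`-spread for some `ρ < 1`: it contains `K` with probability at most `ρ ^ #K`. If `K` is the set of
known tuples, then the message has probability at most `ρ ^ #K`. There are at most `3 ^ b` messages
of at most `b` bits, so by Jensen's inequality the average number of known tuples is at most `C * b`
with `C = log 3 / -log ρ`.

Every tuple of `S_j` has the same probability, and Friedgut's inequality for the packing `u_c` shows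
that machine `c` outputs on average at most `E * ∏ j, (C * N_c / m_j) ^ u_{c,j}` tuples, where `E`
is the expected size of `q(I)`. If the load `B` is so small that `C * B` is below the least
admissible load, then the sum of these bounds over all machines is less than `E`.
-/

open Finset

section Averages

variable {ι α : Type*}

theorem prod_rpow_le_one_sub_add_sum {s : Finset ι} {v z : ι → ℝ} (hv₀ : ∀ j ∈ s, 0 ≤ v j)
    (hv₁ : ∑ j ∈ s, v j ≤ 1) (hz : ∀ j ∈ s, 0 ≤ z j) :
    ∏ j ∈ s, z j ^ v j ≤ (1 - ∑ j ∈ s, v j) + ∑ j ∈ s, v j * z j := by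
  have amgm := Real.geom_mean_le_arith_mean_weighted (insertNone s)
    (fun o => o.elim (1 - ∑ j ∈ s, v j) v) (fun o => o.elim 1 z)
    (by rintro (_ | j) hj <;> simp_all) (by simp) (by rintro (_ | j) hj <;> simp_all)
  simpa using amgm

theorem expect_prod_rpow_le [Fintype α] [Nonempty α] {s : Finset ι} {f : ι → α → ℝ} {v : ι → ℝ}
    (hf : ∀ j ∈ s, ∀ a, 0 ≤ f j a) (hv₀ : ∀ j ∈ s, 0 ≤ v j) (hv₁ : ∑ j ∈ s, v j ≤ 1) :
    𝔼 a, ∏ j ∈ s, f j a ^ v j ≤ ∏ j ∈ s, (𝔼 a, f j a) ^ v j := by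
  set M : ι → ℝ := fun j => 𝔼 a, f j a
  have hM : ∀ j ∈ s, 0 ≤ M j := fun j hj => expect_nonneg fun a _ => hf j hj a
  have hfM : ∀ j ∈ s, ∀ a, 0 ≤ f j a / M j := fun j hj a => div_nonneg (hf j hj a) (hM j hj)
  have normalize : ∀ a, ∏ j ∈ s, f j a ^ v j =
      (∏ j ∈ s, M j ^ v j) * ∏ j ∈ s, (f j a / M j) ^ v j := by
    intro a
    rw [← prod_mul_distrib]
    refine prod_congr rfl fun j hj => ?_
    have hzero (h : M j = 0) : f j a = 0 :=
      (expect_eq_zero_iff_of_nonneg fun a _ => hf j hj a).1 h a (mem_univ a)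
    rw [← Real.mul_rpow (hM j hj) (hfM j hj a), mul_div_cancel_of_imp' hzero]
  have normalized_le_one : 𝔼 a, ∏ j ∈ s, (f j a / M j) ^ v j ≤ 1 :=
    calc 𝔼 a, ∏ j ∈ s, (f j a / M j) ^ v j
        ≤ 𝔼 a, ((1 - ∑ j ∈ s, v j) + ∑ j ∈ s, v j * (f j a / M j)) :=
          expect_le_expect fun a _ =>
            prod_rpow_le_one_sub_add_sum hv₀ hv₁ fun j hj => hfM j hj a
      _ = (1 - ∑ j ∈ s, v j) + ∑ j ∈ s, v j * (M j / M j) := by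
          simp only [expect_add_distrib, Fintype.expect_const, expect_sum_comm, ← mul_expect,
            ← expect_div, M]
      _ ≤ (1 - ∑ j ∈ s, v j) + ∑ j ∈ s, v j := by
          gcongr with j hj
          exact mul_le_of_le_one_right (hv₀ j hj) (div_self_le_one _)
      _ = 1 := sub_add_cancel _ _
  simp only [normalize, ← mul_expect]
  exact mul_le_of_le_one_right (prod_nonneg fun j hj => Real.rpow_nonneg (hM j hj) _)
    normalized_le_one

theorem expect_fin_cons [Fintype α] (k : ℕ) (F : (Fin (k + 1) → α) → ℝ) :
    𝔼 b : Fin k → α, 𝔼 x, F (Fin.cons x b) = 𝔼 a, F a := by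
  rw [expect_comm, ← expect_product', univ_product_univ]
  exact Fintype.expect_equiv (Fin.consEquiv fun _ => α) _ _ fun _ => rfl

theorem dependsOn_expect_fin_cons [Fintype α] {k : ℕ} {F : (Fin (k + 1) → α) → ℝ}
    {e : Set (Fin (k + 1))} (hF : DependsOn F e) :
    DependsOn (fun b : Fin k → α => 𝔼 x, F (Fin.cons x b)) {i | i.succ ∈ e} := fun a b hab =>
  expect_congr rfl fun x _ => hF fun i hi => by
    induction i using Fin.cases with
    | zero => rfl
    | succ i => exact hab i hi

theorem expect_fin_cons_eq_of_dependsOn [Fintype α] [Nonempty α] {k : ℕ}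
    {F : (Fin (k + 1) → α) → ℝ} {e : Set (Fin (k + 1))} (hF : DependsOn F e) (he : 0 ∉ e)
    (x : α) (b : Fin k → α) : 𝔼 y, F (Fin.cons y b) = F (Fin.cons x b) := by
  have hconst : ∀ y, F (Fin.cons y b) = F (Fin.cons x b) := fun y => hF fun i hi => by
    induction i using Fin.cases with
    | zero => exact absurd hi he
    | succ i => rfl
  simp only [hconst, Fintype.expect_const]

theorem expect_fin_cons_prod_rpow_le [Fintype ι] [Fintype α] [Nonempty α] {k : ℕ} {v : ι → ℝ}
    {f : ι → (Fin (k + 1) → α) → ℝ} {e : ι → Set (Fin (k + 1))} [DecidablePred fun j => 0 ∈ e j]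
    (hv₀ : ∀ j, 0 ≤ v j) (hf : ∀ j a, 0 ≤ f j a) (hdep : ∀ j, DependsOn (f j) (e j))
    (hv₁ : ∑ j with 0 ∈ e j, v j ≤ 1) (b : Fin k → α) :
    𝔼 x, ∏ j, f j (Fin.cons x b) ^ v j ≤ ∏ j, (𝔼 x, f j (Fin.cons x b)) ^ v j := by
  have hsplit (g : ι → ℝ) : ∏ j, g j = (∏ j with 0 ∉ e j, g j) * ∏ j with 0 ∈ e j, g j := by
    rw [mul_comm, prod_filter_mul_prod_filter_not]
  have hfree (x : α) : ∏ j with 0 ∉ e j, f j (Fin.cons x b) ^ v j =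
      ∏ j with 0 ∉ e j, (𝔼 y, f j (Fin.cons y b)) ^ v j :=
    prod_congr rfl fun j hj => by
      rw [expect_fin_cons_eq_of_dependsOn (hdep j) (mem_filter.1 hj).2 x b]
  simp only [hsplit, hfree, ← mul_expect]
  refine mul_le_mul_of_nonneg_left ?_
    (prod_nonneg fun j _ => Real.rpow_nonneg (expect_nonneg fun x _ => hf j _) _)
  exact expect_prod_rpow_le (fun j _ x => hf j _) (fun j _ => hv₀ j) hv₁

-- Friedgut's inequality: the coordinates are averaged out one at a time by Hölder's inequality.
theorem expect_prod_rpow_le_of_packing [Fintype ι] [Fintype α] [Nonempty α] {k : ℕ} {v : ι → ℝ}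
    {f : ι → (Fin k → α) → ℝ} {e : ι → Set (Fin k)} [∀ i, DecidablePred fun j => i ∈ e j]
    (hv₀ : ∀ j, 0 ≤ v j) (hf : ∀ j a, 0 ≤ f j a) (hdep : ∀ j, DependsOn (f j) (e j))
    (hv₁ : ∀ i, ∑ j with i ∈ e j, v j ≤ 1) :
    𝔼 a, ∏ j, f j a ^ v j ≤ ∏ j, (𝔼 a, f j a) ^ v j := by
  induction k with
  | zero => simp only [univ_unique, expect_singleton, le_refl]
  | succ k ih =>
    calc 𝔼 a, ∏ j, f j a ^ v j
        = 𝔼 b : Fin k → α, 𝔼 x, ∏ j, f j (Fin.cons x b) ^ v j :=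
          (expect_fin_cons k fun a => ∏ j, f j a ^ v j).symm
      _ ≤ 𝔼 b : Fin k → α, ∏ j, (𝔼 x, f j (Fin.cons x b)) ^ v j :=
          expect_le_expect fun b _ => expect_fin_cons_prod_rpow_le hv₀ hf hdep (hv₁ 0) b
      _ ≤ ∏ j, (𝔼 b : Fin k → α, 𝔼 x, f j (Fin.cons x b)) ^ v j :=
          ih (fun j b => expect_nonneg fun x _ => hf j _)
            (fun j => dependsOn_expect_fin_cons (hdep j)) fun i => hv₁ i.succ
      _ = ∏ j, (𝔼 a, f j a) ^ v j := by simp only [expect_fin_cons]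

theorem expect_comp_of_injective {κ : Type*} [Fintype ι] [Fintype κ] [DecidableEq ι]
    [DecidableEq κ] [Fintype α] [Nonempty α] {σ : ι → κ} (hσ : Function.Injective σ)
    (f : (ι → α) → ℝ) : 𝔼 a : κ → α, f (a ∘ σ) = 𝔼 b, f b := by
  classical
  let split : (κ → α) ≃ (ι → α) × ({x // x ∉ Set.range σ} → α) :=
    (Equiv.piEquivPiSubtypeProd (· ∈ Set.range σ) fun _ => α).trans
      (Equiv.prodCongrLeft fun _ => (Equiv.ofInjective σ hσ).symm.arrowCongr (Equiv.refl α))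
  rw [Fintype.expect_equiv split (fun a => f (a ∘ σ)) (fun x => f x.1) fun _ => rfl,
    ← univ_product_univ, expect_product]
  simp only [Fintype.expect_const]

theorem expect_prod_piFinset [Fintype ι] [DecidableEq ι] {β : ι → Type*} (D : ∀ j, Finset (β j))
    (f : ∀ j, β j → ℝ) :
    𝔼 x ∈ Fintype.piFinset D, ∏ j, f j (x j) = ∏ j, 𝔼 y ∈ D j, f j y := by
  simp only [expect_eq_sum_div_card, prod_div_distrib, prod_univ_sum, Fintype.card_piFinset,
    Nat.cast_prod]

theorem expect_le_log_expect_exp {s : Finset α} (hs : s.Nonempty) (f : α → ℝ) :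
    𝔼 a ∈ s, f a ≤ Real.log (𝔼 a ∈ s, Real.exp (f a)) := by
  rw [Real.le_log_iff_exp_le (expect_pos (fun a _ => Real.exp_pos _) hs)]
  have jensen := convexOn_exp.map_sum_le (t := s) (w := fun _ => (#s : ℝ)⁻¹) (p := f)
    (fun _ _ => by positivity) (by simp [hs.card_ne_zero]) fun _ _ => Set.mem_univ _
  simpa only [expect_eq_sum_div_card, smul_eq_mul, inv_mul_eq_div, ← sum_div] using jensen

end Averages

section Information

variable {α β : Type*}

theorem card_le_pow_of_length_le [Fintype β] {s : Finset (List β)} {N : ℕ}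
    (hs : ∀ x ∈ s, x.length ≤ N) : #s ≤ (Fintype.card β + 1) ^ N := by
  let entries (x : List β) (i : Fin N) : Option β := x[i]?
  have entries_injOn : Set.InjOn entries s := fun x hx y hy hxy => List.ext_getElem? fun i => by
    rcases lt_or_ge i N with hi | hi
    · exact congrFun hxy ⟨i, hi⟩
    · rw [List.getElem?_eq_none ((hs x hx).trans hi), List.getElem?_eq_none ((hs y hy).trans hi)]
  calc #s ≤ #(univ : Finset (Fin N → Option β)) :=
        card_le_card_of_injOn entries (fun _ _ => mem_coe.2 (mem_univ _)) entries_injOn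
    _ = (Fintype.card β + 1) ^ N := by simp

variable [DecidableEq α]

/-- A family `D` of finite sets is `ρ`-spread if a uniformly random member of `D` contains a given
finite set `K` with probability at most `ρ ^ #K`. -/
def IsSpread (ρ : ℝ) (D : Finset (Finset α)) : Prop :=
  ∀ K, (#{S ∈ D | K ⊆ S} : ℝ) ≤ ρ ^ #K * #D

variable [Fintype α] [DecidableEq β]

/-- The elements that a recipient of the message `f S` knows to belong to `S`, given that `S` is a
member of `D`: those contained in every member of `D` with the same message. -/
def knownElements (D : Finset (Finset α)) (f : Finset α → β) (S : Finset α) : Finset α :=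
  {t | ∀ S' ∈ D, f S' = f S → t ∈ S'}

theorem knownElements_subset {D : Finset (Finset α)} {f : Finset α → β} {S : Finset α}
    (hS : S ∈ D) : knownElements D f S ⊆ S := fun _ ht => (mem_filter.1 ht).2 S hS rfl

theorem knownElements_congr {D : Finset (Finset α)} {f : Finset α → β} {S S' : Finset α}
    (h : f S = f S') : knownElements D f S = knownElements D f S' := by
  simp only [knownElements, h]

-- The members of `D` with the same message as `S` all contain `knownElements D f S`, so there are
-- at most `ρ ^ #(knownElements D f S) * #D` of them.
theorem expect_inv_pow_card_knownElements_le {D : Finset (Finset α)} {ρ : ℝ} (hρ : 0 < ρ)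
    (hspread : IsSpread ρ D) (f : Finset α → β) :
    𝔼 S ∈ D, (ρ ^ #(knownElements D f S))⁻¹ ≤ #(D.image f) := by
  have fiber_le : ∀ y ∈ D.image f, ∑ S ∈ D with f S = y, (ρ ^ #(knownElements D f S))⁻¹ ≤ #D := by
    intro y hy
    obtain ⟨S₀, -, rfl⟩ := mem_image.1 hy
    set K := knownElements D f S₀
    have fiber_subset : {S ∈ D | f S = f S₀} ⊆ {S ∈ D | K ⊆ S} := fun S hS => by
      rw [mem_filter] at hS ⊢
      exact ⟨hS.1, (knownElements_congr hS.2).symm.trans_subset (knownElements_subset hS.1)⟩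
    calc ∑ S ∈ D with f S = f S₀, (ρ ^ #(knownElements D f S))⁻¹
        = #{S ∈ D | f S = f S₀} * (ρ ^ #K)⁻¹ := by
          rw [← nsmul_eq_mul]
          exact sum_eq_card_nsmul fun S hS => by rw [knownElements_congr (mem_filter.1 hS).2]
      _ ≤ #{S ∈ D | K ⊆ S} * (ρ ^ #K)⁻¹ := by gcongr
      _ ≤ ρ ^ #K * #D * (ρ ^ #K)⁻¹ := by gcongr; exact hspread K
      _ = #D := by field_simp
  rw [expect_eq_sum_div_card]
  refine div_le_of_le_mul₀ (Nat.cast_nonneg _) (Nat.cast_nonneg _) ?_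
  calc ∑ S ∈ D, (ρ ^ #(knownElements D f S))⁻¹
      = ∑ y ∈ D.image f, ∑ S ∈ D with f S = y, (ρ ^ #(knownElements D f S))⁻¹ :=
        (sum_fiberwise_of_maps_to (fun S hS => mem_image_of_mem f hS) _).symm
    _ ≤ #(D.image f) * (#D : ℝ) := (sum_le_sum fiber_le).trans_eq (by simp)

theorem expect_card_knownElements_le_log {D : Finset (Finset α)} (hD : D.Nonempty) {ρ : ℝ}
    (hρ₀ : 0 < ρ) (hρ₁ : ρ < 1) (hspread : IsSpread ρ D) (f : Finset α → β) :
    𝔼 S ∈ D, (#(knownElements D f S) : ℝ) ≤ Real.log #(D.image f) / -Real.log ρ := by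
  rw [le_div_iff₀ (neg_pos.2 (Real.log_neg hρ₀ hρ₁))]
  have exp_eq (S : Finset α) : Real.exp (#(knownElements D f S) * -Real.log ρ) =
      (ρ ^ #(knownElements D f S))⁻¹ := by
    rw [mul_neg, Real.exp_neg, mul_comm, Real.exp_mul, Real.exp_log hρ₀, Real.rpow_natCast]
  calc (𝔼 S ∈ D, (#(knownElements D f S) : ℝ)) * -Real.log ρ
      = 𝔼 S ∈ D, #(knownElements D f S) * -Real.log ρ := expect_mul ..
    _ ≤ Real.log (𝔼 S ∈ D, Real.exp (#(knownElements D f S) * -Real.log ρ)) :=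
        expect_le_log_expect_exp hD _
    _ = Real.log (𝔼 S ∈ D, (ρ ^ #(knownElements D f S))⁻¹) := by simp only [exp_eq]
    _ ≤ Real.log #(D.image f) :=
        Real.log_le_log (expect_pos (fun _ _ => by positivity) hD)
          (expect_inv_pow_card_knownElements_le hρ₀ hspread f)

/-- A bound for the average number of elements of a random member of a `ρ`-spread family that
become known per bit of a message. The factor `Real.log 3` is due to the count `3 ^ N` for the bit
strings of length at most `N`. -/
noncomputable def elementsPerBit (ρ : ℝ) : ℝ := Real.log 3 / -Real.log ρ

theorem elementsPerBit_pos {ρ : ℝ} (hρ₀ : 0 < ρ) (hρ₁ : ρ < 1) : 0 < elementsPerBit ρ :=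
  div_pos (Real.log_pos (by norm_num)) (neg_pos.2 (Real.log_neg hρ₀ hρ₁))

theorem expect_card_knownElements_le {D : Finset (Finset α)} (hD : D.Nonempty) {ρ : ℝ}
    (hρ₀ : 0 < ρ) (hρ₁ : ρ < 1) (hspread : IsSpread ρ D) {msg : Finset α → List Bool} {B : ℝ}
    (hB : ∀ S ∈ D, ((msg S).length : ℝ) ≤ B) :
    𝔼 S ∈ D, (#(knownElements D msg S) : ℝ) ≤ elementsPerBit ρ * B := by
  have hB₀ : 0 ≤ B := hD.elim fun S hS => (Nat.cast_nonneg _).trans (hB S hS)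
  have card_image_le : #(D.image msg) ≤ 3 ^ ⌊B⌋₊ :=
    card_le_pow_of_length_le fun x hx => by
      obtain ⟨S, hS, rfl⟩ := mem_image.1 hx
      exact Nat.le_floor (hB S hS)
  have log_card_image_le : Real.log #(D.image msg) ≤ Real.log 3 * B :=
    calc Real.log #(D.image msg) ≤ Real.log (3 ^ ⌊B⌋₊) :=
          Real.log_le_log (by exact_mod_cast (hD.image msg).card_pos)
            (by exact_mod_cast card_image_le)
      _ = ⌊B⌋₊ * Real.log 3 := Real.log_pow _ _
      _ ≤ B * Real.log 3 := by gcongr; exact Nat.floor_le hB₀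
      _ = Real.log 3 * B := mul_comm _ _
  rw [elementsPerBit, div_mul_eq_mul_div]
  exact (expect_card_knownElements_le_log hD hρ₀ hρ₁ hspread msg).trans
    (div_le_div_of_nonneg_right log_card_image_le (neg_pos.2 (Real.log_neg hρ₀ hρ₁)).le)

end Information

section InclusionProbability

variable {α β : Type*} [DecidableEq α]

/-- The probability that `t` belongs to the random set `F S`, for `S` uniform in `D`. -/
noncomputable def inclusionProb (D : Finset β) (F : β → Finset α) (t : α) : ℝ :=
  𝔼 S ∈ D, if t ∈ F S then 1 else 0

theorem inclusionProb_nonneg (D : Finset β) (F : β → Finset α) (t : α) :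
    0 ≤ inclusionProb D F t := expect_nonneg fun _ _ => by split_ifs <;> norm_num

theorem inclusionProb_mono {D : Finset β} {F G : β → Finset α} (h : ∀ S ∈ D, F S ⊆ G S) (t : α) :
    inclusionProb D F t ≤ inclusionProb D G t :=
  expect_le_expect fun S hS => by
    by_cases ht : t ∈ F S
    · rw [if_pos ht, if_pos (h S hS ht)]
    · rw [if_neg ht]; split_ifs <;> norm_num

theorem inclusionProb_id (D : Finset (Finset α)) (t : α) :
    inclusionProb D id t = #{S ∈ D | {t} ⊆ S} / #D := by
  simp only [inclusionProb, expect_eq_sum_div_card, sum_boole, id_eq, singleton_subset_iff]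

theorem sum_inclusionProb [Fintype α] (D : Finset β) (F : β → Finset α) :
    ∑ t, inclusionProb D F t = 𝔼 S ∈ D, (#(F S) : ℝ) := by
  simp only [inclusionProb, ← expect_sum_comm, sum_boole, filter_univ_mem]

end InclusionProbability

theorem update_mem_piFinset {ι : Type*} [Fintype ι] [DecidableEq ι] {β : ι → Type*}
    {D : ∀ j, Finset (β j)} {I : ∀ j, β j} (hI : I ∈ Fintype.piFinset D) {j : ι} {S : β j}
    (hS : S ∈ D j) : Function.update I j S ∈ Fintype.piFinset D := by
  simp only [Fintype.mem_piFinset] at hI ⊢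
  exact (Function.forall_update_iff I fun j' S' => S' ∈ D j').2 ⟨hS, fun j' _ => hI j'⟩

namespace ConjunctiveQuery

variable {k l n : ℕ} {q : ConjunctiveQuery k l}

theorem expect_card_eval {β : Fin l → Type*} (D : ∀ j, Finset (β j))
    (F : ∀ j, β j → Relation n (q.arity j)) :
    𝔼 I ∈ Fintype.piFinset D, (#(q.eval fun j => F j (I j)) : ℝ) =
      ∑ a : Fin k → Fin n, ∏ j, inclusionProb (D j) (F j) (a ∘ q.var j) := by
  have card_eval (I : ∀ j, β j) : (#(q.eval fun j => F j (I j)) : ℝ) =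
      ∑ a : Fin k → Fin n, ∏ j, if a ∘ q.var j ∈ F j (I j) then 1 else 0 := by
    simp only [eval, natCast_card_filter, Fintype.prod_boole, Function.comp_def]
    congr!
  simp only [card_eval, expect_sum_comm, inclusionProb]
  exact sum_congr rfl fun a _ =>
    expect_prod_piFinset D fun j S => if a ∘ q.var j ∈ F j S then (1 : ℝ) else 0

theorem expectedSize_eq_expect (D : Finset (q.Database n)) :
    q.expectedSize D = 𝔼 I ∈ D, (#(q.eval I) : ℝ) := (expect_eq_sum_div_card _ _).symm

theorem expectedSize_piFinset {D : ∀ j, Finset (Relation n (q.arity j))} {d : Fin l → ℝ}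
    (hd : ∀ j t, inclusionProb (D j) id t = d j) :
    q.expectedSize (Fintype.piFinset D) = n ^ k * ∏ j, d j := by
  rw [expectedSize_eq_expect]
  exact (expect_card_eval D fun _ => id).trans (by simp [hd])

theorem IsFractionalEdgePacking.le_one {v : Fin l → ℝ} (hv : q.IsFractionalEdgePacking v)
    (j : Fin l) : v j ≤ 1 :=
  let i₀ : Fin (q.arity j) := ⟨0, q.arity_pos j⟩
  (single_le_sum (fun j _ => hv.1 j) (mem_filter.2 ⟨mem_univ j, i₀, rfl⟩)).trans
    (hv.2 (q.var j i₀))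

theorem IsFractionalEdgePacking.expect_prod_le {α : Type*} [Fintype α] [Nonempty α]
    {v : Fin l → ℝ} (hv : q.IsFractionalEdgePacking v) {h : ∀ j, (Fin (q.arity j) → α) → ℝ}
    (h₀ : ∀ j t, 0 ≤ h j t) (h₁ : ∀ j t, h j t ≤ 1) :
    𝔼 a : Fin k → α, ∏ j, h j (a ∘ q.var j) ≤ ∏ j, (𝔼 t, h j t) ^ v j := by
  classical
  calc 𝔼 a : Fin k → α, ∏ j, h j (a ∘ q.var j)
      ≤ 𝔼 a : Fin k → α, ∏ j, h j (a ∘ q.var j) ^ v j :=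
        expect_le_expect fun a _ => prod_le_prod (fun j _ => h₀ j _) fun j _ =>
          Real.self_le_rpow_of_le_one (h₀ j _) (h₁ j _) (hv.le_one j)
    _ ≤ ∏ j, (𝔼 a : Fin k → α, h j (a ∘ q.var j)) ^ v j :=
        expect_prod_rpow_le_of_packing (e := fun j => Set.range (q.var j)) hv.1
          (fun j a => h₀ j _)
          (fun j a b hab => congrArg (h j) (funext fun i => hab _ (Set.mem_range_self i)))
          fun i => by simpa only [Set.mem_range] using hv.2 i
    _ = ∏ j, (𝔼 t, h j t) ^ v j := by simp only [expect_comp_of_injective (q.var_injective _)]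

theorem IsFractionalEdgePacking.expect_card_eval_le [NeZero n] {v : Fin l → ℝ}
    (hv : q.IsFractionalEdgePacking v) {D : ∀ j, Finset (Relation n (q.arity j))} {d : Fin l → ℝ}
    (hd₀ : ∀ j, 0 < d j) (hd : ∀ j t, inclusionProb (D j) id t = d j)
    {F : ∀ j, Relation n (q.arity j) → Relation n (q.arity j)}
    (hF : ∀ j, ∀ S ∈ D j, F j S ⊆ S) :
    𝔼 I ∈ Fintype.piFinset D, (#(q.eval fun j => F j (I j)) : ℝ) ≤
      q.expectedSize (Fintype.piFinset D) *
        ∏ j, ((𝔼 S ∈ D j, (#(F j S) : ℝ)) / (d j * n ^ q.arity j)) ^ v j := by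
  set h : ∀ j, (Fin (q.arity j) → Fin n) → ℝ := fun j t => inclusionProb (D j) (F j) t / d j
  have h_nonneg : ∀ j t, 0 ≤ h j t := fun j t =>
    div_nonneg (inclusionProb_nonneg ..) (hd₀ j).le
  have h_le_one : ∀ j t, h j t ≤ 1 := fun j t =>
    div_le_one_of_le₀ ((inclusionProb_mono (hF j) t).trans_eq (hd j t)) (hd₀ j).le
  have expect_h (j : Fin l) : 𝔼 t, h j t = (𝔼 S ∈ D j, (#(F j S) : ℝ)) / (d j * n ^ q.arity j) := by
    rw [← expect_div, Fintype.expect_eq_sum_div_card, sum_inclusionProb, div_div, mul_comm (d j)]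
    simp
  have inclusionProb_eq (j : Fin l) (t) : inclusionProb (D j) (F j) t = d j * h j t :=
    (mul_div_cancel₀ _ (hd₀ j).ne').symm
  calc 𝔼 I ∈ Fintype.piFinset D, (#(q.eval fun j => F j (I j)) : ℝ)
      = (∏ j, d j) * ∑ a : Fin k → Fin n, ∏ j, h j (a ∘ q.var j) := by
        simp only [expect_card_eval, inclusionProb_eq, prod_mul_distrib, ← mul_sum]
    _ = q.expectedSize (Fintype.piFinset D) * 𝔼 a : Fin k → Fin n, ∏ j, h j (a ∘ q.var j) := by
        rw [expectedSize_piFinset hd, mul_comm _ (∏ j, d j), mul_assoc, ← Fintype.card_mul_expect]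
        simp
    _ ≤ q.expectedSize (Fintype.piFinset D) *
          ∏ j, ((𝔼 S ∈ D j, (#(F j S) : ℝ)) / (d j * n ^ q.arity j)) ^ v j := by
        simp only [← expect_h]
        refine mul_le_mul_of_nonneg_left (hv.expect_prod_le h_nonneg h_le_one) ?_
        rw [expectedSize_eq_expect]
        exact expect_nonneg fun _ _ => Nat.cast_nonneg _

-- Replacing one relation by another one with the same message does not change the output, so the
-- output has to be correct for the modified input, too.
theorem out_subset_eval_knownElements {β : Type*} [DecidableEq β]
    {D : ∀ j, Finset (Relation n (q.arity j))} {msg : ∀ j, Relation n (q.arity j) → β}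
    {out : (Fin l → β) → Finset (Fin k → Fin n)}
    (sound : ∀ I ∈ Fintype.piFinset D, out (fun j => msg j (I j)) ⊆ q.eval I)
    {I : q.Database n} (hI : I ∈ Fintype.piFinset D) :
    out (fun j => msg j (I j)) ⊆ q.eval fun j => knownElements (D j) (msg j) (I j) := by
  simp only [subset_iff, eval, knownElements, mem_filter, mem_univ, true_and] at sound ⊢
  intro a ha j S hS hmsg
  have same_messages : (fun j' => msg j' (Function.update I j S j')) = fun j' => msg j' (I j') := by
    ext j'
    rw [Function.apply_update msg, hmsg]
    simp
  simpa using sound _ (update_mem_piFinset hI hS) (same_messages ▸ ha) j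

end ConjunctiveQuery

/-- A nonempty `ρ`-spread family of sets, a uniformly random member of which contains every element
of `α` with the same probability `m / |α|`. -/
structure IsRegularSpread {α : Type*} [Fintype α] [DecidableEq α] (ρ : ℝ) (m : ℕ)
    (D : Finset (Finset α)) : Prop where
  nonempty : D.Nonempty
  inclusionProb_eq : ∀ t, inclusionProb D id t = m / Fintype.card α
  isSpread : IsSpread ρ D

theorem ConjunctiveQuery.expectedSize_piFinset_pos {k l n : ℕ} [NeZero n]
    {q : ConjunctiveQuery k l} {D : ∀ j, Finset (Relation n (q.arity j))} {m : Fin l → ℕ} {ρ : ℝ}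
    (hm : ∀ j, 0 < m j) (hD : ∀ j, IsRegularSpread ρ (m j) (D j)) :
    0 < q.expectedSize (Fintype.piFinset D) := by
  rw [expectedSize_piFinset fun j => (hD j).inclusionProb_eq]
  have hn : (0 : ℝ) < n := Nat.cast_pos.2 (NeZero.pos n)
  exact mul_pos (pow_pos hn k) (prod_pos fun j _ =>
    div_pos (Nat.cast_pos.2 (hm j)) (Nat.cast_pos.2 Fintype.card_pos))

namespace OneRoundAlgorithm

variable {k l n p : ℕ} {q : ConjunctiveQuery k l} {Ω : Type u} {A : OneRoundAlgorithm q n p Ω}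
  {D : ∀ j, Finset (Relation n (q.arity j))}

theorem length_msg_le (hD : ∀ j, (D j).Nonempty) {ω : Ω} {c : Fin p} {B : ℝ}
    (hB : ∀ I ∈ Fintype.piFinset D, (A.bitsReceived ω I c : ℝ) ≤ B) (j : Fin l)
    {S : Relation n (q.arity j)} (hS : S ∈ D j) : ((A.msg ω c j S).length : ℝ) ≤ B := by
  obtain ⟨I, hI⟩ := Fintype.piFinset_nonempty.2 hD
  refine le_trans (Nat.cast_le.2 ?_) (hB _ (update_mem_piFinset hI hS))
  simpa only [Function.update_self, bitsReceived] using
    single_le_sum (f := fun j' => (A.msg ω c j' (Function.update I j S j')).length)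
      (fun _ _ => Nat.zero_le _) (mem_univ j)

theorem bitsReceived_le_of_load_le {D : Finset (q.Database n)} {w : Fin p → ℝ} {B : ℝ}
    (hB₀ : 0 ≤ B) (hB : A.load w D ≤ ENNReal.ofReal B) (ω : Ω) {c : Fin p} (hw : 0 ≤ w c)
    {I : q.Database n} (hI : I ∈ D) : (A.bitsReceived ω I c : ℝ) ≤ B * w c := by
  have cost_le : (A.bitsReceived ω I c : ℝ≥0∞) / ENNReal.ofReal (w c) ≤ ENNReal.ofReal B := by
    refine le_trans ?_ hB
    exact le_iSup_of_le ω (le_iSup₂_of_le I hI (le_iSup (fun c => _ / ENNReal.ofReal (w c)) c))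
  rwa [ENNReal.div_le_iff_le_mul (.inr ENNReal.ofReal_ne_top) (.inl ENNReal.ofReal_ne_top),
    ← ENNReal.ofReal_mul hB₀, ← ENNReal.ofReal_natCast,
    ENNReal.ofReal_le_ofReal_iff (mul_nonneg hB₀ hw)] at cost_le

theorem IsSoundOn.out_subset {D : Finset (q.Database n)} (hA : A.IsSoundOn D) (ω : Ω) (c : Fin p)
    {I : q.Database n} (hI : I ∈ D) :
    A.out ω c (fun j => A.msg ω c j (I j)) ⊆ q.eval I :=
  (subset_biUnion_of_mem (fun c => A.out ω c fun j => A.msg ω c j (I j)) (mem_univ c)).trans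
    (hA ω I hI)

section RegularSpread

variable [NeZero n] {m : Fin l → ℕ} {ρ : ℝ}

theorem expect_card_out_le (hA : A.IsSoundOn (Fintype.piFinset D)) (hρ₀ : 0 < ρ) (hρ₁ : ρ < 1)
    (hm : ∀ j, 0 < m j) (hD : ∀ j, IsRegularSpread ρ (m j) (D j)) {v : Fin l → ℝ}
    (hv : q.IsFractionalEdgePacking v) {ω : Ω} {c : Fin p} {B : ℝ}
    (hB : ∀ I ∈ Fintype.piFinset D, (A.bitsReceived ω I c : ℝ) ≤ B) :
    𝔼 I ∈ Fintype.piFinset D, (#(A.out ω c fun j => A.msg ω c j (I j)) : ℝ) ≤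
      q.expectedSize (Fintype.piFinset D) * ∏ j, (elementsPerBit ρ * B / m j) ^ v j := by
  set known : ∀ j, Relation n (q.arity j) → Relation n (q.arity j) := fun j =>
    knownElements (D j) (A.msg ω c j)
  have hcard (j : Fin l) : (0 : ℝ) < Fintype.card (Fin (q.arity j) → Fin n) :=
    Nat.cast_pos.2 Fintype.card_pos
  have hsize (j : Fin l) : (m j / Fintype.card (Fin (q.arity j) → Fin n) : ℝ) * n ^ q.arity j =
      m j := by simp
  calc 𝔼 I ∈ Fintype.piFinset D, (#(A.out ω c fun j => A.msg ω c j (I j)) : ℝ)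
      ≤ 𝔼 I ∈ Fintype.piFinset D, (#(q.eval fun j => known j (I j)) : ℝ) :=
        expect_le_expect fun I hI => Nat.cast_le.2 <| card_le_card <|
          ConjunctiveQuery.out_subset_eval_knownElements (fun _ => hA.out_subset ω c) hI
    _ ≤ q.expectedSize (Fintype.piFinset D) *
          ∏ j, ((𝔼 S ∈ D j, (#(known j S) : ℝ)) / m j) ^ v j := by
        simpa only [hsize] using hv.expect_card_eval_le
          (fun j => div_pos (Nat.cast_pos.2 (hm j)) (hcard j)) (fun j => (hD j).inclusionProb_eq)
          fun _ _ => knownElements_subset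
    _ ≤ q.expectedSize (Fintype.piFinset D) * ∏ j, (elementsPerBit ρ * B / m j) ^ v j := by
        have := (ConjunctiveQuery.expectedSize_piFinset_pos hm hD).le
        gcongr with j _
        · exact hv.1 j
        · exact expect_card_knownElements_le (hD j).nonempty hρ₀ hρ₁ (hD j).isSpread fun S =>
            length_msg_le (fun j => (hD j).nonempty) hB j

theorem expect_card_output_le (hA : A.IsSoundOn (Fintype.piFinset D)) (hρ₀ : 0 < ρ) (hρ₁ : ρ < 1)
    (hm : ∀ j, 0 < m j) (hD : ∀ j, IsRegularSpread ρ (m j) (D j)) {v : Fin p → Fin l → ℝ}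
    (hv : ∀ c, q.IsFractionalEdgePacking (v c)) {ω : Ω} {B : Fin p → ℝ}
    (hB : ∀ c, ∀ I ∈ Fintype.piFinset D, (A.bitsReceived ω I c : ℝ) ≤ B c) :
    𝔼 I ∈ Fintype.piFinset D, (#(A.output ω I) : ℝ) ≤
      q.expectedSize (Fintype.piFinset D) *
        ∑ c, ∏ j, (elementsPerBit ρ * B c / m j) ^ v c j :=
  calc 𝔼 I ∈ Fintype.piFinset D, (#(A.output ω I) : ℝ)
      ≤ 𝔼 I ∈ Fintype.piFinset D, ∑ c, (#(A.out ω c fun j => A.msg ω c j (I j)) : ℝ) :=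
        expect_le_expect fun _ _ => by exact_mod_cast card_biUnion_le
    _ = ∑ c, 𝔼 I ∈ Fintype.piFinset D, (#(A.out ω c fun j => A.msg ω c j (I j)) : ℝ) :=
        expect_sum_comm ..
    _ ≤ ∑ c, q.expectedSize (Fintype.piFinset D) *
          ∏ j, (elementsPerBit ρ * B c / m j) ^ v c j :=
        sum_le_sum fun c _ => expect_card_out_le hA hρ₀ hρ₁ hm hD (hv c) (hB c)
    _ = q.expectedSize (Fintype.piFinset D) *
          ∑ c, ∏ j, (elementsPerBit ρ * B c / m j) ^ v c j := (mul_sum ..).symm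

theorem expectedOutput_le [MeasurableSpace Ω] {P : MeasureTheory.Measure Ω}
    [MeasureTheory.IsProbabilityMeasure P] (hA : A.IsSoundOn (Fintype.piFinset D)) (hρ₀ : 0 < ρ)
    (hρ₁ : ρ < 1) (hm : ∀ j, 0 < m j) (hD : ∀ j, IsRegularSpread ρ (m j) (D j))
    {v : Fin p → Fin l → ℝ} (hv : ∀ c, q.IsFractionalEdgePacking (v c)) {B : Fin p → ℝ}
    (hB : ∀ ω c, ∀ I ∈ Fintype.piFinset D, (A.bitsReceived ω I c : ℝ) ≤ B c) :
    A.expectedOutput P (Fintype.piFinset D) ≤ q.expectedSize (Fintype.piFinset D) *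
      ∑ c, ∏ j, (elementsPerBit ρ * B c / m j) ^ v c j := by
  set b := q.expectedSize (Fintype.piFinset D) *
    ∑ c, ∏ j, (elementsPerBit ρ * B c / m j) ^ v c j
  calc A.expectedOutput P (Fintype.piFinset D) ≤ ∫ _, b ∂P :=
        MeasureTheory.integral_mono_of_nonneg
          (.of_forall fun ω => div_nonneg (by positivity) (Nat.cast_nonneg _))
          (MeasureTheory.integrable_const _) (.of_forall fun ω => by
            simpa only [expect_eq_sum_div_card] using
              expect_card_output_le hA hρ₀ hρ₁ hm hD hv (hB ω))
    _ = b := by simp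

end RegularSpread

end OneRoundAlgorithm

theorem oneRoundLoadAtLeast_of_isRegularSpread {k l n p : ℕ} [NeZero n] {q : ConjunctiveQuery k l}
    {D : ∀ j, Finset (Relation n (q.arity j))} {m : Fin l → ℕ} {w : Fin p → ℝ}
    {v : Fin p → Fin l → ℝ} {ρ L : ℝ} (hρ₀ : 0 < ρ) (hρ₁ : ρ < 1) (hm : ∀ j, 0 < m j)
    (hD : ∀ j, IsRegularSpread ρ (m j) (D j)) (hw : ∀ c, 0 ≤ w c)
    (hv : ∀ c, q.IsFractionalEdgePacking (v c)) (hL : L ∈ lowerBounds (admissibleLoads m w v)) :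
    OneRoundLoadAtLeast.{u} q (Fintype.piFinset D) w ((elementsPerBit ρ)⁻¹ * L) := by
  intro Ω _ P _ A hA hout
  by_contra! hload
  set E := q.expectedSize (Fintype.piFinset D)
  set C := elementsPerBit ρ
  have hE : 0 < E := ConjunctiveQuery.expectedSize_piFinset_pos hm hD
  have hC : 0 < C := elementsPerBit_pos hρ₀ hρ₁
  set B := (A.load w (Fintype.piFinset D)).toReal
  have hB₀ : 0 ≤ B := ENNReal.toReal_nonneg
  have hB : C * B < L :=
    (lt_inv_mul_iff₀ hC).1 (ENNReal.toReal_lt_of_lt_ofReal hload)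
  have not_admissible : ∑ c, ∏ j, (C * B * w c / m j) ^ v c j < 1 := by
    by_contra! h
    exact hB.not_ge (hL ⟨mul_nonneg hC.le hB₀, h⟩)
  have output_le : A.expectedOutput P (Fintype.piFinset D) ≤
      E * ∑ c, ∏ j, (C * (B * w c) / m j) ^ v c j :=
    OneRoundAlgorithm.expectedOutput_le hA hρ₀ hρ₁ hm hD hv fun ω c _ =>
      OneRoundAlgorithm.bitsReceived_le_of_load_le hB₀ (ENNReal.ofReal_toReal hload.ne_top).ge ω
        (hw c)
  simp only [← mul_assoc C] at output_le
  exact (hout.trans output_le).not_gt (mul_lt_of_lt_one_right hE not_admissible)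

section AdmissibleLoads

variable {l p : ℕ} {m : Fin l → ℕ} {w : Fin p → ℝ} {v : Fin p → Fin l → ℝ}

theorem isClosed_admissibleLoads (hv : ∀ c j, 0 ≤ v c j) : IsClosed (admissibleLoads m w v) :=
  (isClosed_le continuous_const continuous_id).inter <|
    isClosed_le continuous_const <| continuous_finsetSum _ fun c _ =>
      continuous_finsetProd _ fun j _ =>
        Continuous.rpow_const (by fun_prop) fun _ => .inr (hv c j)

theorem admissibleLoads_nonempty (hm : ∀ j, 0 < m j) (hw : ∀ c, 0 ≤ w c) (hw' : ∃ c, 0 < w c)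
    (hv : ∀ c j, 0 ≤ v c j) : (admissibleLoads m w v).Nonempty := by
  obtain ⟨c, hc⟩ := hw'
  have hm' (j : Fin l) : (0 : ℝ) < m j := Nat.cast_pos.2 (hm j)
  set L : ℝ := (∑ j, (m j : ℝ)) / w c
  have hL : 0 ≤ L := div_nonneg (sum_nonneg fun j _ => (hm' j).le) hc.le
  refine ⟨L, hL, ?_⟩
  calc (1 : ℝ) ≤ ∏ j, (L * w c / m j) ^ v c j :=
        one_le_prod fun j _ => Real.one_le_rpow (by
          rw [div_mul_cancel₀ _ hc.ne', one_le_div (hm' j)]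
          exact single_le_sum (fun j _ => (hm' j).le) (mem_univ j)) (hv c j)
    _ ≤ ∑ c, ∏ j, (L * w c / m j) ^ v c j :=
        single_le_sum (f := fun c => ∏ j, (L * w c / m j) ^ v c j)
          (fun c _ => prod_nonneg fun j _ =>
            Real.rpow_nonneg (div_nonneg (mul_nonneg hL (hw c)) (hm' j).le) _) (mem_univ c)

theorem exists_isLeast_admissibleLoads (hm : ∀ j, 0 < m j) (hw : ∀ c, 0 ≤ w c)
    (hw' : ∃ c, 0 < w c) (hv : ∀ c j, 0 ≤ v c j) : ∃ L, IsLeast (admissibleLoads m w v) L :=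
  ⟨_, (isClosed_admissibleLoads hv).isLeast_csInf (admissibleLoads_nonempty hm hw hw' hv)
    ⟨0, fun _ hL => hL.1⟩⟩

end AdmissibleLoads

theorem natCast_sub_le_mul {m n : ℕ} {ρ : ℝ} (hρ₀ : 0 ≤ ρ) (hρ₁ : ρ ≤ 1) (hm : (m : ℝ) ≤ ρ * n)
    (k : ℕ) : ((m - k : ℕ) : ℝ) ≤ ρ * (n - k : ℕ) := by
  rcases le_total m k with hmk | hkm
  · rw [Nat.sub_eq_zero_of_le hmk, Nat.cast_zero]
    positivity
  · have hmn : m ≤ n := Nat.cast_le.1 (hm.trans (mul_le_of_le_one_left n.cast_nonneg hρ₁))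
    rw [Nat.cast_sub hkm, Nat.cast_sub (hkm.trans hmn)]
    linarith [mul_le_of_le_one_left (k.cast_nonneg (α := ℝ)) hρ₁]

theorem descFactorial_le_pow_mul_descFactorial {m n : ℕ} {ρ : ℝ} (hρ₀ : 0 ≤ ρ) (hρ₁ : ρ ≤ 1)
    (hm : (m : ℝ) ≤ ρ * n) (k : ℕ) : (m.descFactorial k : ℝ) ≤ ρ ^ k * n.descFactorial k := by
  induction k with
  | zero => simp
  | succ k ih =>
    calc (m.descFactorial (k + 1) : ℝ) = (m - k : ℕ) * m.descFactorial k := by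
          rw [Nat.descFactorial_succ, Nat.cast_mul]
      _ ≤ (ρ * (n - k : ℕ)) * (ρ ^ k * n.descFactorial k) := by
          gcongr
          exact natCast_sub_le_mul hρ₀ hρ₁ hm k
      _ = ρ ^ (k + 1) * n.descFactorial (k + 1) := by
          rw [Nat.descFactorial_succ, Nat.cast_mul]
          ring

-- In place of `3 / 4`, any `x < 1` with `2 * x ^ 2 ≥ 1` would do.
theorem one_le_three_quarters_pow_mul_factorial {k : ℕ} (hk : 2 ≤ k) :
    (1 : ℝ) ≤ (3 / 4) ^ k * k.factorial := by
  induction k, hk using Nat.le_induction with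
  | base => norm_num [Nat.factorial]
  | succ k hk ih =>
    have hk' : (2 : ℝ) ≤ k := Nat.ofNat_le_cast.2 hk
    calc (1 : ℝ) ≤ 3 / 4 * (k + 1) * ((3 / 4) ^ k * k.factorial) :=
          one_le_mul_of_one_le_of_one_le (by linarith) ih
      _ = (3 / 4) ^ (k + 1) * (k + 1).factorial := by
          rw [Nat.factorial_succ]
          push_cast
          ring

theorem one_le_three_quarters_pow_mul_descFactorial {n k : ℕ} (hn : 2 ≤ n) (hk : k ≤ n) :
    (1 : ℝ) ≤ (3 / 4) ^ k * n.descFactorial k := by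
  rcases lt_or_ge k 2 with hk₂ | hk₂
  · have hn' : (2 : ℝ) ≤ n := Nat.ofNat_le_cast.2 hn
    interval_cases k
    · simp
    · rw [pow_one, Nat.descFactorial_one]
      linarith
  · refine (one_le_three_quarters_pow_mul_factorial hk₂).trans ?_
    gcongr
    exact (Nat.descFactorial_self k).symm.trans_le (Nat.descFactorial_le k hk)

theorem descFactorial_le_pow_mul_descFactorial_pow {m n r k : ℕ} {ρ : ℝ} (hρ : 3 / 4 ≤ ρ)
    (hρ₁ : ρ ≤ 1) (hn : 2 ≤ n) (hk : k ≤ n) (hr : 0 < r) (hm : m ≤ n)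
    (hmρ : r = 1 → (m : ℝ) ≤ ρ * n) :
    (m.descFactorial k : ℝ) ≤ ρ ^ k * (n.descFactorial k) ^ r := by
  rcases Nat.eq_or_lt_of_le hr with rfl | hr₂
  · rw [Nat.succ_eq_one_add, add_zero, pow_one]
    exact descFactorial_le_pow_mul_descFactorial (by linarith) hρ₁ (hmρ rfl) k
  · have hone : (1 : ℝ) ≤ n.descFactorial k := Nat.one_le_cast.2 (Nat.descFactorial_pos.2 hk)
    calc (m.descFactorial k : ℝ) ≤ 1 * n.descFactorial k := by
          rw [one_mul]
          exact_mod_cast Nat.descFactorial_le k hm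
      _ ≤ (3 / 4) ^ k * n.descFactorial k * n.descFactorial k := by
          gcongr
          exact one_le_three_quarters_pow_mul_descFactorial hn hk
      _ = (3 / 4) ^ k * n.descFactorial k ^ 2 := by ring
      _ ≤ ρ ^ k * n.descFactorial k ^ r := by
          gcongr
          exact hr₂

section SpreadFamilies

variable {α : Type*} [DecidableEq α]

theorem descFactorial_mul_card_filter_powersetCard [Fintype α] (m : ℕ) (K : Finset α) :
    (Fintype.card α).descFactorial #K * #{S ∈ univ.powersetCard m | K ⊆ S} =
      m.descFactorial #K * #(univ.powersetCard m : Finset (Finset α)) := by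
  rcases lt_or_ge m #K with hmK | hKm
  · have no_superset : #{S ∈ (univ : Finset α).powersetCard m | K ⊆ S} = 0 :=
      card_eq_zero.2 <| filter_eq_empty_iff.2 fun S hS hKS =>
        hmK.not_ge ((card_le_card hKS).trans_eq (mem_powersetCard.1 hS).2)
    rw [no_superset, Nat.descFactorial_of_lt hmK, mul_zero, zero_mul]
  · rw [card_filter_powersetCard_subset _ _ _ (subset_univ K) hKm, card_powersetCard, card_univ]
    calc (Fintype.card α).descFactorial #K * (Fintype.card α - #K).choose (m - #K)
        = (#K).factorial *
            ((Fintype.card α).choose #K * (Fintype.card α - #K).choose (m - #K)) := by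
          rw [Nat.descFactorial_eq_factorial_mul_choose, mul_assoc]
      _ = (#K).factorial * ((Fintype.card α).choose m * m.choose #K) := by rw [Nat.choose_mul hKm]
      _ = m.descFactorial #K * (Fintype.card α).choose m := by
          rw [Nat.descFactorial_eq_factorial_mul_choose]
          ring

theorem card_filter_subset_le_of_perm {D : Finset (Finset α)} {e : Equiv.Perm α}
    (he : ∀ S ∈ D, S.map e.toEmbedding ∈ D) {K K' : Finset α}
    (hK : K' = K.map e.toEmbedding) : #{S ∈ D | K ⊆ S} ≤ #{S ∈ D | K' ⊆ S} :=
  card_le_card_of_injOn (fun S => S.map e.toEmbedding) (fun S hS => by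
    rw [mem_coe, mem_filter] at hS ⊢
    exact ⟨he S hS.1, hK ▸ map_subset_map.2 hS.2⟩) (map_injective _).injOn

-- Count the pairs of a `t ∈ T` and an `S ∈ D` that contains `insert t K`.
theorem card_mul_card_filter_insert_subset {D : Finset (Finset α)} {m : ℕ} {K T : Finset α}
    (hm : ∀ S ∈ D, #S = m) (hT : ∀ S ∈ D, K ⊆ S → T ∩ S = S \ K)
    (hsymm : ∀ t ∈ T, ∀ t' ∈ T, ∃ e : Equiv.Perm α,
      e t = t' ∧ (∀ s ∈ K, e s = s) ∧ ∀ S ∈ D, S.map e.toEmbedding ∈ D) {t : α} (ht : t ∈ T) :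
    #T * #{S ∈ D | insert t K ⊆ S} = (m - #K) * #{S ∈ D | K ⊆ S} := by
  have card_le : ∀ t ∈ T, ∀ t' ∈ T,
      #{S ∈ D | insert t K ⊆ S} ≤ #{S ∈ D | insert t' K ⊆ S} := by
    intro t ht t' ht'
    obtain ⟨e, rfl, heK, heD⟩ := hsymm t ht t' ht'
    refine card_filter_subset_le_of_perm heD ?_
    have map_K : K.map e.toEmbedding = K := by
      rw [map_eq_image]
      exact (image_congr fun s hs => heK s hs).trans image_id
    rw [map_insert, map_K]
    rfl
  have card_eq : ∀ t' ∈ T, #{S ∈ {S ∈ D | K ⊆ S} | t' ∈ S} = #{S ∈ D | insert t K ⊆ S} := by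
    intro t' ht'
    rw [filter_filter, ← (card_le t' ht' t ht).antisymm (card_le t ht t' ht')]
    simp only [insert_subset_iff, and_comm]
  rw [← sum_card_inter card_eq, mul_comm]
  refine sum_const_nat fun S hS => ?_
  obtain ⟨hSD, hKS⟩ := mem_filter.1 hS
  rw [hT S hSD hKS, card_sdiff_of_subset hKS, hm S hSD]

theorem inclusionProb_id_eq_div_card [Fintype α] {D : Finset (Finset α)}
    (hD : D.Nonempty) {m : ℕ} {t : α}
    (ht : Fintype.card α * #{S ∈ D | {t} ⊆ S} = m * #D) :
    inclusionProb D id t = m / Fintype.card α := by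
  have : Nonempty α := ⟨t⟩
  rw [inclusionProb_id, div_eq_div_iff (Nat.cast_ne_zero.2 hD.card_ne_zero)
    (Nat.cast_ne_zero.2 Fintype.card_ne_zero), mul_comm]
  exact_mod_cast ht

theorem card_filter_subset_le_of_mul_eq {D : Finset (Finset α)} {K : Finset α} {a b : ℕ} {x : ℝ}
    (hb : 0 < b) (hK : b * #{S ∈ D | K ⊆ S} = a * #D) (hab : (a : ℝ) ≤ x * b) :
    (#{S ∈ D | K ⊆ S} : ℝ) ≤ x * #D := by
  refine le_of_mul_le_mul_left ?_ (Nat.cast_pos.2 hb : (0 : ℝ) < b)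
  calc (b * #{S ∈ D | K ⊆ S} : ℝ) = a * #D := by exact_mod_cast hK
    _ ≤ x * b * #D := by gcongr
    _ = b * (x * #D) := by ring

theorem isRegularSpread_powersetCard [Fintype α] {m : ℕ} {ρ : ℝ} (hρ₀ : 0 ≤ ρ)
    (hρ₁ : ρ ≤ 1) (hm : (m : ℝ) ≤ ρ * Fintype.card α) :
    IsRegularSpread ρ m (univ.powersetCard m : Finset (Finset α)) := by
  have nonempty : (univ.powersetCard m : Finset (Finset α)).Nonempty :=
    powersetCard_nonempty.2 <| Nat.cast_le.1 <|
      hm.trans (mul_le_of_le_one_left (Nat.cast_nonneg (α := ℝ) _) hρ₁)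
  refine ⟨nonempty, fun t => ?_, fun K => ?_⟩
  · exact inclusionProb_id_eq_div_card nonempty <| by
      simpa only [card_singleton, Nat.descFactorial_one] using
        descFactorial_mul_card_filter_powersetCard m {t}
  · exact card_filter_subset_le_of_mul_eq (Nat.descFactorial_pos.2 (card_le_univ K))
      (descFactorial_mul_card_filter_powersetCard m K)
      (descFactorial_le_pow_mul_descFactorial hρ₀ hρ₁ hm #K)

end SpreadFamilies

section Matchings

variable {n r m : ℕ} {K : Relation n r}

open Classical in
/-- The matchings with `m` tuples, out of which a matching database picks one for every atom. -/
noncomputable def matchings (n r m : ℕ) : Finset (Relation n r) :=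
  {R | #R = m ∧ R.IsMatching}

theorem mem_matchings {R : Relation n r} : R ∈ matchings n r m ↔ #R = m ∧ R.IsMatching := by
  simp [matchings]

theorem matchings_nonempty (hr : 0 < r) (hm : m ≤ n) : (matchings n r m).Nonempty := by
  have diagonal_injective :
      Function.Injective fun (i : Fin m) (_ : Fin r) => Fin.castLE hm i :=
    fun _ _ h => Fin.castLE_injective hm (congrFun h ⟨0, hr⟩)
  refine ⟨univ.map ⟨_, diagonal_injective⟩, mem_matchings.2 ⟨by simp, fun a s hs t ht h => ?_⟩⟩
  obtain ⟨i, -, rfl⟩ := mem_map.1 hs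
  obtain ⟨j, -, rfl⟩ := mem_map.1 ht
  exact congrArg _ (Fin.castLE_injective hm h)

theorem isMatching_of_subset {R S : Relation n r} (hS : S.IsMatching) (hRS : R ⊆ S) :
    R.IsMatching :=
  fun a s hs t ht => hS a s (hRS hs) t (hRS ht)

theorem card_image_eval_of_isMatching (hK : K.IsMatching) (a : Fin r) :
    #(K.image fun s => s a) = #K :=
  card_image_of_injOn fun s hs t ht => hK a s hs t ht

theorem card_le_of_isMatching (hr : 0 < r) (hK : K.IsMatching) : #K ≤ n := by
  rw [← card_image_eval_of_isMatching hK ⟨0, hr⟩]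
  exact card_finset_fin_le _

theorem map_piCongrRight_mem_matchings {R : Relation n r} (hR : R ∈ matchings n r m)
    (e : Fin r → Equiv.Perm (Fin n)) :
    R.map (Equiv.piCongrRight e).toEmbedding ∈ matchings n r m := by
  obtain ⟨hcard, hR⟩ := mem_matchings.1 hR
  refine mem_matchings.2 ⟨by rw [card_map, hcard], fun a s hs t ht h => ?_⟩
  obtain ⟨s', hs', rfl⟩ := mem_map.1 hs
  obtain ⟨t', ht', rfl⟩ := mem_map.1 ht
  rw [hR a s' hs' t' ht' ((e a).injective h)]

/-- The tuples that differ in every attribute from every tuple of `K`, which are those by which a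
nonempty matching `K` can be extended. -/
def freshTuples (K : Relation n r) : Relation n r :=
  Fintype.piFinset fun a => (K.image fun s => s a)ᶜ

theorem mem_freshTuples {t : Fin r → Fin n} : t ∈ freshTuples K ↔ ∀ s ∈ K, ∀ a, s a ≠ t a := by
  simp only [freshTuples, Fintype.mem_piFinset, mem_compl, mem_image, not_exists, not_and]
  exact forall_comm.trans (forall_congr' fun _ => forall_comm)

theorem card_freshTuples (hK : K.IsMatching) : #(freshTuples K) = (n - #K) ^ r := by
  simp [freshTuples, Fintype.card_piFinset, card_compl, card_image_eval_of_isMatching hK]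

theorem sdiff_subset_freshTuples {S : Relation n r} (hS : S.IsMatching) (hKS : K ⊆ S) :
    S \ K ⊆ freshTuples K := fun t ht => by
  rw [mem_sdiff] at ht
  exact mem_freshTuples.2 fun s hs a hst => ht.2 (hS a s (hKS hs) t ht.1 hst ▸ hs)

theorem freshTuples_inter_eq_sdiff (hr : 0 < r) {S : Relation n r} (hS : S.IsMatching)
    (hKS : K ⊆ S) : freshTuples K ∩ S = S \ K := by
  refine Subset.antisymm (fun t ht => ?_)
    (subset_inter (sdiff_subset_freshTuples hS hKS) sdiff_subset)
  rw [mem_inter, mem_freshTuples] at ht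
  exact mem_sdiff.2 ⟨ht.2, fun htK => ht.1 t htK ⟨0, hr⟩ rfl⟩

theorem pow_mul_card_filter_insert_subset_matchings (hr : 0 < r) (hK : K.IsMatching)
    {t : Fin r → Fin n} (ht : t ∈ freshTuples K) :
    (n - #K) ^ r * #{S ∈ matchings n r m | insert t K ⊆ S} =
      (m - #K) * #{S ∈ matchings n r m | K ⊆ S} := by
  rw [← card_freshTuples hK]
  refine card_mul_card_filter_insert_subset (fun S hS => (mem_matchings.1 hS).1)
    (fun S hS => freshTuples_inter_eq_sdiff hr (mem_matchings.1 hS).2) ?_ ht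
  intro t ht t' ht'
  rw [mem_freshTuples] at ht ht'
  exact ⟨Equiv.piCongrRight fun a => Equiv.swap (t a) (t' a),
    funext fun a => Equiv.swap_apply_left _ _,
    fun s hs => funext fun a => Equiv.swap_apply_of_ne_of_ne (ht s hs a) (ht' s hs a),
    fun S hS => map_piCongrRight_mem_matchings hS _⟩

theorem descFactorial_pow_mul_card_filter_matchings (hr : 0 < r) (hK : K.IsMatching) :
    n.descFactorial #K ^ r * #{S ∈ matchings n r m | K ⊆ S} =
      m.descFactorial #K * #(matchings n r m) := by
  induction K using Finset.induction_on with
  | empty => simp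
  | insert t K ht ih =>
    have hK' : Relation.IsMatching K := isMatching_of_subset hK (subset_insert t K)
    have ht' : t ∈ freshTuples K := sdiff_subset_freshTuples hK (subset_insert t K)
      (mem_sdiff.2 ⟨mem_insert_self t K, ht⟩)
    rw [card_insert_of_notMem ht, Nat.descFactorial_succ, Nat.descFactorial_succ]
    calc ((n - #K) * n.descFactorial #K) ^ r * #{S ∈ matchings n r m | insert t K ⊆ S}
        = n.descFactorial #K ^ r *
            ((n - #K) ^ r * #{S ∈ matchings n r m | insert t K ⊆ S}) := by ring
      _ = (m - #K) * (n.descFactorial #K ^ r * #{S ∈ matchings n r m | K ⊆ S}) := by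
          rw [pow_mul_card_filter_insert_subset_matchings hr hK' ht']
          ring
      _ = (m - #K) * m.descFactorial #K * #(matchings n r m) := by rw [ih hK', mul_assoc]

theorem filter_subset_matchings_eq_empty (hK : ¬ K.IsMatching) :
    {S ∈ matchings n r m | K ⊆ S} = ∅ :=
  filter_eq_empty_iff.2 fun _ hS hKS => hK (isMatching_of_subset (mem_matchings.1 hS).2 hKS)

theorem isMatching_singleton (t : Fin r → Fin n) : Relation.IsMatching {t} :=
  fun _ _ hs _ ht _ => (mem_singleton.1 hs).trans (mem_singleton.1 ht).symm

theorem isRegularSpread_matchings {ρ : ℝ} (hρ : 3 / 4 ≤ ρ) (hρ₁ : ρ ≤ 1) (hn : 2 ≤ n)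
    (hr : 0 < r) (hm : m ≤ n) (hmρ : r = 1 → (m : ℝ) ≤ ρ * n) :
    IsRegularSpread ρ m (matchings n r m) := by
  refine ⟨matchings_nonempty hr hm, fun t => ?_, fun K => ?_⟩
  · exact inclusionProb_id_eq_div_card (matchings_nonempty hr hm) <| by
      simpa using descFactorial_pow_mul_card_filter_matchings hr (isMatching_singleton t)
  · by_cases hK : Relation.IsMatching K
    · have hKn : #K ≤ n := card_le_of_isMatching hr hK
      refine card_filter_subset_le_of_mul_eq (pow_pos (Nat.descFactorial_pos.2 hKn) r)
        (descFactorial_pow_mul_card_filter_matchings hr hK) ?_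
      exact_mod_cast descFactorial_le_pow_mul_descFactorial_pow hρ hρ₁ hn hKn hr hm hmρ
    · rw [filter_subset_matchings_eq_empty hK, card_empty, Nat.cast_zero]
      positivity

end Matchings

namespace ConjunctiveQuery

variable {k l : ℕ}

theorem instances_eq_piFinset (q : ConjunctiveQuery k l) (n : ℕ) (m : Fin l → ℕ) :
    q.instances n m = Fintype.piFinset fun j => univ.powersetCard (m j) := by
  ext I
  simp [instances, Fintype.mem_piFinset, mem_powersetCard]

theorem matchingInstances_eq_piFinset (q : ConjunctiveQuery k l) (n : ℕ) (m : Fin l → ℕ) :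
    q.matchingInstances n m = Fintype.piFinset fun j => matchings n (q.arity j) (m j) := by
  ext I
  simp [matchingInstances, Fintype.mem_piFinset, mem_matchings]

end ConjunctiveQuery

theorem mainTheorem9_general (θ : ℝ) (hθ₁ : θ < 1) :
    ∃ κ : ℝ, 0 < κ ∧
      ∀ (k l n p : ℕ) (q : ConjunctiveQuery k l) (m : Fin l → ℕ) (w : Fin p → ℝ)
        (v : Fin p → Fin l → ℝ),
        2 ≤ n → (∀ j, 1 ≤ m j) → (∀ c, 0 ≤ w c) → (∃ c, 0 < w c) →
        (∀ c, q.IsFractionalEdgePacking (v c)) →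
        ∃ L : ℝ, IsLeast (admissibleLoads m w v) L ∧
          ((∀ j, m j ≤ n ∧ (q.arity j = 1 → (m j : ℝ) ≤ θ * n)) →
            OneRoundLoadAtLeast.{u} q (q.matchingInstances n m) w (κ * L)) ∧
          ((∀ j, (m j : ℝ) ≤ θ * (n : ℝ) ^ q.arity j) →
            OneRoundLoadAtLeast.{u} q (q.instances n m) w (κ * L)) := by
  obtain ⟨ρ, hθρ, hρ, hρ₁⟩ : ∃ ρ : ℝ, θ ≤ ρ ∧ 3 / 4 ≤ ρ ∧ ρ < 1 :=
    ⟨max θ (3 / 4), le_max_left _ _, le_max_right _ _, max_lt hθ₁ (by norm_num)⟩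
  have hρ₀ : 0 < ρ := by linarith
  refine ⟨(elementsPerBit ρ)⁻¹, inv_pos.2 (elementsPerBit_pos hρ₀ hρ₁), ?_⟩
  intro k l n p q m w v hn hm hw hw' hv
  have : NeZero n := ⟨by lia⟩
  obtain ⟨L, hL⟩ := exists_isLeast_admissibleLoads hm hw hw' fun c => (hv c).1
  refine ⟨L, hL, fun hmatching => ?_, fun hdense => ?_⟩
  · rw [q.matchingInstances_eq_piFinset]
    refine oneRoundLoadAtLeast_of_isRegularSpread hρ₀ hρ₁ hm (fun j => ?_) hw hv hL.2
    exact isRegularSpread_matchings hρ hρ₁.le hn (q.arity_pos j) (hmatching j).1 fun hr =>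
      ((hmatching j).2 hr).trans (by gcongr)
  · rw [q.instances_eq_piFinset]
    refine oneRoundLoadAtLeast_of_isRegularSpread hρ₀ hρ₁ hm (fun j => ?_) hw hv hL.2
    refine isRegularSpread_powersetCard hρ₀.le hρ₁.le ((hdense j).trans ?_)
    rw [Fintype.card_fun, Fintype.card_fin, Fintype.card_fin, Nat.cast_pow]
    gcongr

theorem mainTheorem9 (θ : ℝ) (hθ₀ : 0 < θ) (hθ₁ : θ < 1) :
    ∃ κ : ℝ, 0 < κ ∧
      ∀ (k l n p : ℕ) (q : ConjunctiveQuery k l) (m : Fin l → ℕ) (w : Fin p → ℝ)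
        (v : Fin p → Fin l → ℝ),
        2 ≤ n → (∀ j, 1 ≤ m j) → (∀ c, 0 ≤ w c) → (∃ c, 0 < w c) →
        (∀ c, q.IsFractionalEdgePacking (v c)) →
        ∃ L : ℝ, IsLeast (admissibleLoads m w v) L ∧
          ((∀ j, m j ≤ n ∧ (q.arity j = 1 → (m j : ℝ) ≤ θ * n)) →
            OneRoundLoadAtLeast.{u} q (q.matchingInstances n m) w (κ * L)) ∧
          ((∀ j, (m j : ℝ) = θ * (n : ℝ) ^ q.arity j) →
            OneRoundLoadAtLeast.{u} q (q.instances n m) w (κ * L)) := by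
  obtain ⟨κ, hκ, h⟩ := mainTheorem9_general.{u} θ hθ₁
  refine ⟨κ, hκ, fun k l n p q m w v hn hm hw hw' hv => ?_⟩
  obtain ⟨L, hL, hmatching, hinstances⟩ := h k l n p q m w v hn hm hw hw' hv
  exact ⟨L, hL, hmatching, fun hdense => hinstances fun j => (hdense j).le⟩
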